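/- Let $(\Omega,P)$ be a probability space and let $\psi$ be a random real function on $\mathbb R^2$ (the gravitational potential): $\psi(x)$ is a random variable for each $x$. Let the lens plane $L$ be the (random) open set of points near which $\psi$ is $C^\infty$; assume that $\mathbb R^2\setminus L$ is a random closed set which almost surely has Lebesgue measure zero. Let $\eta(x)=x-\nabla\psi(x)$ be the lensing map, $T_y(x)=\tfrac12|x-y|^2-\psi(x)$ the time delay function, $$\kappa=\tfrac12(\psi_{11}+\psi_{22}),\qquad \Gamma_1=\tfrac12(\psi_{11}-\psi_{22}),\qquad \Gamma_2=\psi_{12},\qquad \Gamma^2=\Gamma_1^2+\Gamma_2^2,$$ where $\psi_{ij}=\partial^2\psi/\partial x_i\partial x_j$, and $\mathcal G_A=\{\nu:\det(\mathrm{Jac}\,\eta)(\nu)>0\}$. A lensed image of a source at $y$ is a critical point $x\in L$ of $T_y$, that is, a solution $x \in L$ of $\eta(x)=y$. For $D\subset\mathbb R^2$, let $N_+(D,y)$ be the number of positive parity images in $D$, i.e. the number of nondegenerate critical points of $T_y$ in $D\cap L$ of Morse index $0$ (minima) plus the number of those of Morse index $2$ (maxima). Let $D$ be a closed disk such that, for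 almost every $x\in D$, the random vector $\eta(x)$ has a probability density function $f_{\eta(x)}$. Assume: 1. images are almost surely not critical points: for almost every $y\in\mathbb R^2$, $P\big[\exists\, x\in D\cap L:\ \eta(x)=y \text{ and } \det(\mathrm{Jac}\,\eta)(x)=0\big]=0$; 2. $\kappa$ is bounded on $L$: there is a constant $K$ such that almost surely $|\kappa(x)|\le K$ for all $x\in L$. Then, for almost every $y$, $N_+(D,y)$ is (almost surely equal to) a random variable and $E[N_+(D,y)]<\infty$; there are versions of $f_{\eta(x)}(y)$ and of the conditional expectations below that are jointly measurable in $(x,y)$; and, whichever such versions are used, for every continuous test function $\rho:\mathbb R^2\to\mathbb R$ with compact support, $$\int_{\mathbb R^2}\rho(y)\,E[N_+(D,y)]\,dy=\int_{\mathbb R^2}\rho(y)\int_D E\big[\det(\mathrm{Jac}\,\eta)(x)\,\mathbf 1_{\mathcal G_A}(x)\,\big|\,\eta(x)=y\big]\,f_{\eta(x)}(y)\,dx\,dy,$$ and, for almost every $y\in\mathbb R^2$, the Kac–Rice formula $$E[N_+(D,y)]=\int_D E\big[\big((1-\kappa(x))^2-\Gamma^2(x)\big)\mathbf 1_{\mathcal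 G_A}(x)\,\big|\,\eta(x)=y\big]\,f_{\eta(x)}(y)\,dx$$ holds, with all integrals absolutely convergent. -/

import Mathlib

open MeasureTheory Set Filter Topology
open scoped ENNReal

noncomputable section

namespace Lensing

/-- The plane `ℝ²` with its Euclidean structure. -/
abbrev Plane : Type := EuclideanSpace ℝ (Fin 2)

/-- The first partial derivative `∂f/∂xᵢ` at `x`. -/
def partialDeriv (f : Plane → ℝ) (i : Fin 2) (x : Plane) : ℝ :=
  fderiv ℝ f x (EuclideanSpace.single i 1)

/-- The second partial derivative `∂²f/∂xᵢ∂xⱼ` at `x`. -/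
def partialDeriv₂ (f : Plane → ℝ) (i j : Fin 2) (x : Plane) : ℝ :=
  partialDeriv (partialDeriv f j) i x

/-- The Hessian matrix of `f` at `x`. -/
def hessian (f : Plane → ℝ) (x : Plane) : Matrix (Fin 2) (Fin 2) ℝ :=
  Matrix.of fun i j => partialDeriv₂ f i j x

/-- The Morse index of `f` at a critical point `x`: the number of negative eigenvalues of the
Hessian, counted with multiplicity. -/
def morseIndex (f : Plane → ℝ) (x : Plane) : ℕ :=
  (hessian f x).charpoly.roots.countP (fun t => t < 0)

/-- The lens plane of a potential: the open set of points near which the potential is smooth. -/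
def lensPlane (ψ : Plane → ℝ) : Set Plane :=
  {x | ∀ᶠ z in 𝓝 x, ContDiffAt ℝ (⊤ : ℕ∞) ψ z}

/-- The time delay function `T_y(x) = |x - y|²/2 - ψ(x)`. -/
def timeDelay (ψ : Plane → ℝ) (y x : Plane) : ℝ :=
  ‖x - y‖ ^ 2 / 2 - ψ x

/-- The lensing map `η(x) = x - ∇ψ(x)`. -/
def lensMap (ψ : Plane → ℝ) (x : Plane) : Plane :=
  x - gradient ψ x

/-- `det (Jac η)(x)`. -/
def jacDet (ψ : Plane → ℝ) (x : Plane) : ℝ :=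
  (fderiv ℝ (lensMap ψ) x).det

/-- The set `𝒢_A = {ν : det (Jac η)(ν) ∈ A}` for `A = (0, ∞)`. -/
def positiveRegion (ψ : Plane → ℝ) : Set Plane :=
  {ν | jacDet ψ ν ∈ Set.Ioi (0 : ℝ)}

/-- The convergence `κ = (ψ₁₁ + ψ₂₂)/2`. -/
def convergence (ψ : Plane → ℝ) (x : Plane) : ℝ :=
  (partialDeriv₂ ψ 0 0 x + partialDeriv₂ ψ 1 1 x) / 2

/-- The shear component `Γ₁ = (ψ₁₁ - ψ₂₂)/2`. -/
def shear₁ (ψ : Plane → ℝ) (x : Plane) : ℝ :=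
  (partialDeriv₂ ψ 0 0 x - partialDeriv₂ ψ 1 1 x) / 2

/-- The shear component `Γ₂ = ψ₁₂`. -/
def shear₂ (ψ : Plane → ℝ) (x : Plane) : ℝ :=
  partialDeriv₂ ψ 0 1 x

/-- The squared shear magnitude `Γ² = Γ₁² + Γ₂²`. -/
def shearSq (ψ : Plane → ℝ) (x : Plane) : ℝ :=
  shear₁ ψ x ^ 2 + shear₂ ψ x ^ 2

/-- `x` is a lensed image of a source at `y`: a critical point in the lens plane of the time delay
function `T_y`. -/
def IsLensedImage (ψ : Plane → ℝ) (y x : Plane) : Prop :=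
  x ∈ lensPlane ψ ∧ gradient (timeDelay ψ y) x = 0

/-- `x` is a nondegenerate lensed image of a source at `y`. -/
def IsNondegenerateImage (ψ : Plane → ℝ) (y x : Plane) : Prop :=
  IsLensedImage ψ y x ∧ (hessian (timeDelay ψ y) x).det ≠ 0

/-- Minimum images: nondegenerate images of Morse index `0`. -/
def IsMinImage (ψ : Plane → ℝ) (y x : Plane) : Prop :=
  IsNondegenerateImage ψ y x ∧ morseIndex (timeDelay ψ y) x = 0

/-- Maximum images: nondegenerate images of Morse index `2`. -/
def IsMaxImage (ψ : Plane → ℝ) (y x : Plane) : Prop :=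
  IsNondegenerateImage ψ y x ∧ morseIndex (timeDelay ψ y) x = 2

/-- `N₊(D, y) = N_min(D, y) + N_max(D, y)`, possibly infinite. -/
def numPositive (ψ : Plane → ℝ) (D : Set Plane) (y : Plane) : ℕ∞ :=
  {x | x ∈ D ∧ IsMinImage ψ y x}.encard + {x | x ∈ D ∧ IsMaxImage ψ y x}.encard

section Random

variable {Ω : Type*} [MeasurableSpace Ω]

/-- A random potential: `ψ ω x` is a random variable for every `x`, the complement of the lens
plane is a random closed set (the events that it meets a given open set are measurable), and almost
surely this complement, off which the potential is smooth, is Lebesgue null. -/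
structure IsRandomPotential (P : Measure Ω) (ψ : Ω → Plane → ℝ) : Prop where
  measurable_eval : ∀ x, Measurable fun ω => ψ ω x
  measurable_singular : ∀ U : Set Plane, IsOpen U →
    MeasurableSet {ω | ((lensPlane (ψ ω))ᶜ ∩ U).Nonempty}
  ae_null : ∀ᵐ ω ∂P, volume (lensPlane (ψ ω))ᶜ = 0

/-- `E[N₊(D, y)]`, with values in `[0, ∞]`. -/
def expectedPositive (P : Measure Ω) (ψ : Ω → Plane → ℝ) (D : Set Plane) (y : Plane) : ℝ≥0∞ :=
  ∫⁻ ω, (numPositive (ψ ω) D y : ℝ≥0∞) ∂P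

/-- `c` is a version of `v ↦ E[U | V = v]`: it is measurable, integrable for the law of `V`, and
`∫_B c d(law of V) = E[U; V ∈ B]` for every Borel set `B`. -/
structure IsCondExpGiven (P : Measure Ω) (U : Ω → ℝ) (V : Ω → Plane) (c : Plane → ℝ) : Prop where
  aemeasurable : AEMeasurable V P
  integrable : Integrable U P
  measurable_version : Measurable c
  integrable_version : Integrable c (P.map V)
  setIntegral_eq : ∀ B : Set Plane, MeasurableSet B →
    ∫ v in B, c v ∂(P.map V) = ∫ ω in V ⁻¹' B, U ω ∂P

/-- `f x y = f_{η(x)}(y)`: a jointly measurable choice, for almost every `x ∈ D`, of the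
probability density function of the random vector `η(x)`. -/
structure IsDensityField (P : Measure Ω) (ψ : Ω → Plane → ℝ) (D : Set Plane)
    (f : Plane → Plane → ℝ) : Prop where
  measurable_uncurry : Measurable (Function.uncurry f)
  ae_eq_pdf : ∀ᵐ x ∂(volume.restrict D),
    ∀ᵐ y, f x y = (pdf (fun ω => lensMap (ψ ω) x) P volume y).toReal

/-- `c x y = E[U(x) | η(x) = y]`: a jointly measurable choice, for almost every `x ∈ D`, of a
version of the conditional expectation of `U(x)` given the random vector `η(x)`. -/
structure IsCondExpField (P : Measure Ω) (ψ : Ω → Plane → ℝ) (D : Set Plane)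
    (U : Plane → Ω → ℝ) (c : Plane → Plane → ℝ) : Prop where
  measurable_uncurry : Measurable (Function.uncurry c)
  ae_condExp : ∀ᵐ x ∂(volume.restrict D),
    IsCondExpGiven P (U x) (fun ω => lensMap (ψ ω) x) (c x)

/-- The random variable `det (Jac η)(x) · 1_{𝒢_A}(x)`. -/
def jacTerm (ψ : Ω → Plane → ℝ) (x : Plane) (ω : Ω) : ℝ :=
  jacDet (ψ ω) x * (positiveRegion (ψ ω)).indicator (fun _ => (1 : ℝ)) x

/-- The random variable `((1 - κ(x))² - Γ²(x)) · 1_{𝒢_A}(x)`. -/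
def shearTerm (ψ : Ω → Plane → ℝ) (x : Plane) (ω : Ω) : ℝ :=
  ((1 - convergence (ψ ω) x) ^ 2 - shearSq (ψ ω) x) *
    (positiveRegion (ψ ω)).indicator (fun _ => (1 : ℝ)) x

end Random

end Lensing

end

/-!
# The Kac-Rice formula for positive parity images

The formula is the area formula for the lensing map, averaged over the lens.

At a point of the lens plane the Hessian of the time delay function is the Jacobian matrix of the
lensing map `η`. A nondegenerate image has Morse index `0` or `2` exactly when the determinant is
positive, so `N₊(D, y)` is the number of preimages of `y` under `η` in the part of `D` where
`det (Jac η) > 0` (`numPositive_eq`). There `η` is locally injective, and the change of variables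
formula on countably many pieces (`setLIntegral_encard_preimage`) gives, for each realization of
the lens and each Borel set `B`,
`∫_B N₊(D, y) dy = ∫_D (det (Jac η)(x))⁺ 1_B(η(x)) dx`.

Taking expectations requires joint measurability. The potential is measurable in `ω` and smooth in
`x` on the lens plane, so `η` and `det (Jac η)` are jointly measurable there, as limits of
difference quotients (`measurable_lensField`, `measurable_jacField`); and `N₊(D, y)` is measurable
because the existence of an image in an open set reduces to countably many infima of continuous
functions over compact sets (`measurableSet_positivePart_inter`,
`measurable_encard_of_inter_open`). This yields
`∫_B E[N₊(D, y)] dy = ∫_D E[(det (Jac η)(x))⁺; η(x) ∈ B] dx` (`setLIntegral_expectedPositive`).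
As `det (Jac η) = (1 - κ)² - Γ² ≤ (1 + K)²`, both sides are finite.

The inner expectation on the right is `∫_B c x y * f x y dy` for any versions `f` of the density and
`c` of the conditional expectation (`density_mul_condExp`), so after Tonelli the two functions of
`y` in `kacRice` have the same integral over every Borel set and agree almost everywhere. Jointly
measurable versions exist as Radon-Nikodym derivatives of kernels in `x`.
-/

noncomputable section

namespace Lensing

/-! ### Differential calculus on the lens plane -/

lemma isOpen_lensPlane (f : Plane → ℝ) : IsOpen (lensPlane f) :=
  isOpen_setOfPred_eventually_nhds

lemma contDiffAt_of_mem_lensPlane {f : Plane → ℝ} {x : Plane} (hx : x ∈ lensPlane f) :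
    ContDiffAt ℝ (⊤ : ℕ∞) f x :=
  Eventually.self_of_nhds hx

lemma contDiffAt_partialDeriv {f : Plane → ℝ} {x : Plane} (hf : ContDiffAt ℝ (⊤ : ℕ∞) f x)
    (i : Fin 2) : ContDiffAt ℝ (⊤ : ℕ∞) (partialDeriv f i) x :=
  (hf.fderiv_right (m := (⊤ : ℕ∞)) (by simp)).clm_apply contDiffAt_const

lemma contDiffAt_partialDeriv₂ {f : Plane → ℝ} {x : Plane} (hf : ContDiffAt ℝ (⊤ : ℕ∞) f x)
    (i j : Fin 2) : ContDiffAt ℝ (⊤ : ℕ∞) (partialDeriv₂ f i j) x :=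
  contDiffAt_partialDeriv (contDiffAt_partialDeriv hf j) i

lemma gradient_apply (f : Plane → ℝ) (x : Plane) (i : Fin 2) :
    gradient f x i = partialDeriv f i x := by
  have h := EuclideanSpace.inner_single_right (𝕜 := ℝ) i 1 (gradient f x)
  simp only [gradient, InnerProductSpace.toDual_symm_apply] at h
  simpa [partialDeriv, gradient] using h.symm

lemma lensMap_apply (f : Plane → ℝ) (x : Plane) (i : Fin 2) :
    lensMap f x i = x i - partialDeriv f i x := by
  simp [lensMap, gradient_apply]

lemma partialDeriv₂_comm {f : Plane → ℝ} {x : Plane} (hf : ContDiffAt ℝ (⊤ : ℕ∞) f x)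
    (i j : Fin 2) : partialDeriv₂ f i j x = partialDeriv₂ f j i x := by
  have hs : IsSymmSndFDerivAt ℝ f x :=
    hf.isSymmSndFDerivAt (by
      rw [minSmoothness_of_isRCLikeNormedField]; exact WithTop.coe_le_coe.2 (le_top : (2 : ℕ∞) ≤ ⊤))
  have hd : DifferentiableAt ℝ (fderiv ℝ f) x :=
    (hf.fderiv_right (m := (⊤ : ℕ∞)) (by simp)).differentiableAt (by simp)
  have key : ∀ i j : Fin 2, partialDeriv₂ f i j x
      = fderiv ℝ (fderiv ℝ f) x (EuclideanSpace.single i 1) (EuclideanSpace.single j 1) := by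
    intro i j
    simp only [partialDeriv₂]
    unfold partialDeriv
    rw [fderiv_clm_apply hd (by fun_prop)]
    simp
  rw [key, key, hs.eq]

/-- The derivative of `x ↦ x - (∂₀f, ∂₁f)`, coordinate by coordinate. -/
lemma hasFDerivAt_lensMap {f : Plane → ℝ} {x : Plane} (hf : ContDiffAt ℝ (⊤ : ℕ∞) f x) :
    HasFDerivAt (lensMap f) (fderiv ℝ (lensMap f) x) x ∧
      ∀ v i, fderiv ℝ (lensMap f) x v i = v i - fderiv ℝ (partialDeriv f i) x v := by
  have h : ∀ i, HasFDerivAt (fun z => lensMap f z i)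
      (EuclideanSpace.proj i - fderiv ℝ (partialDeriv f i) x) x := by
    intro i
    have h1 : HasFDerivAt (fun z : Plane => z i) (EuclideanSpace.proj i : Plane →L[ℝ] ℝ) x :=
      (EuclideanSpace.proj i : Plane →L[ℝ] ℝ).hasFDerivAt
    have h2 := ((contDiffAt_partialDeriv hf i).differentiableAt (by simp)).hasFDerivAt
    simpa only [lensMap_apply] using h1.fun_sub h2
  have hd : DifferentiableAt ℝ (lensMap f) x :=
    (differentiableAt_euclidean).2 fun i => (h i).differentiableAt
  refine ⟨hd.hasFDerivAt, fun v i => ?_⟩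
  have h3 := ((EuclideanSpace.proj i : Plane →L[ℝ] ℝ).hasFDerivAt.comp x hd.hasFDerivAt).unique
    (h i)
  simpa using congrArg (fun A => A v) h3

/-- The Jacobian matrix of the lensing map is `1 - Hess f`. -/
lemma jacDet_eq {f : Plane → ℝ} {x : Plane} (hf : ContDiffAt ℝ (⊤ : ℕ∞) f x) :
    jacDet f x = (1 - partialDeriv₂ f 0 0 x) * (1 - partialDeriv₂ f 1 1 x)
      - partialDeriv₂ f 0 1 x * partialDeriv₂ f 1 0 x := by
  have h := (hasFDerivAt_lensMap hf).2
  rw [jacDet, ContinuousLinearMap.det,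
    ← LinearMap.det_toMatrix (EuclideanSpace.basisFun (Fin 2) ℝ).toBasis, Matrix.det_fin_two]
  simp only [LinearMap.toMatrix_apply, OrthonormalBasis.coe_toBasis,
    OrthonormalBasis.coe_toBasis_repr_apply, EuclideanSpace.basisFun_apply,
    EuclideanSpace.basisFun_repr, ContinuousLinearMap.coe_coe, h, partialDeriv₂]
  simp [partialDeriv]
  ring

lemma jacDet_eq_convergence_shear {f : Plane → ℝ} {x : Plane}
    (hf : ContDiffAt ℝ (⊤ : ℕ∞) f x) :
    jacDet f x = (1 - convergence f x) ^ 2 - shearSq f x := by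
  rw [jacDet_eq hf, partialDeriv₂_comm hf 1 0, convergence, shearSq, shear₁, shear₂]
  ring

lemma partialDeriv_timeDelay {f : Plane → ℝ} {x : Plane} (hf : ContDiffAt ℝ (⊤ : ℕ∞) f x)
    (y : Plane) (i : Fin 2) :
    partialDeriv (timeDelay f y) i x = x i - y i - partialDeriv f i x := by
  have h1 : HasFDerivAt (fun z : Plane => z - y) (ContinuousLinearMap.id ℝ Plane) x :=
    (hasFDerivAt_id x).sub_const y
  have h2 := (h1.norm_sq.mul_const (2⁻¹ : ℝ)).fun_sub
    (hf.differentiableAt (by simp)).hasFDerivAt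
  have h3 : timeDelay f y = fun z => ‖z - y‖ ^ 2 * 2⁻¹ - f z := by
    ext z; simp [timeDelay, div_eq_mul_inv]
  rw [partialDeriv, h3, h2.fderiv, partialDeriv]
  simp [EuclideanSpace.inner_single_right]

lemma isLensedImage_iff {f : Plane → ℝ} {x y : Plane} :
    IsLensedImage f y x ↔ x ∈ lensPlane f ∧ lensMap f x = y := by
  refine and_congr_right fun hx => ?_
  have h := partialDeriv_timeDelay (contDiffAt_of_mem_lensPlane hx) y
  constructor <;> intro H <;> ext i
  · have := congrArg (fun v : Plane => v i) H
    simp only [gradient_apply, h, PiLp.zero_apply] at this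
    rw [lensMap_apply]; linarith
  · have := congrArg (fun v : Plane => v i) H
    simp only [lensMap_apply] at this
    rw [gradient_apply, h, ← this]; simp

/-- The Hessian of the time delay function is `1 - Hess f`. -/
lemma partialDeriv₂_timeDelay {f : Plane → ℝ} {x : Plane} (hx : x ∈ lensPlane f)
    (y : Plane) (i j : Fin 2) :
    partialDeriv₂ (timeDelay f y) i j x = (if i = j then 1 else 0) - partialDeriv₂ f i j x := by
  have he : partialDeriv (timeDelay f y) j =ᶠ[𝓝 x] fun z => z j - y j - partialDeriv f j z :=
    Eventually.mono hx fun z hz => partialDeriv_timeDelay hz y j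
  have h1 : HasFDerivAt (fun z : Plane => z j) (EuclideanSpace.proj j : Plane →L[ℝ] ℝ) x :=
    (EuclideanSpace.proj j : Plane →L[ℝ] ℝ).hasFDerivAt
  have h2 := ((contDiffAt_partialDeriv (contDiffAt_of_mem_lensPlane hx) j).differentiableAt
    (by simp)).hasFDerivAt
  have h3 := ((h1.sub_const (y j)).fun_sub h2).fderiv
  rw [partialDeriv₂, partialDeriv, he.fderiv_eq, h3, partialDeriv₂]
  simp [partialDeriv, eq_comm]

lemma det_hessian_timeDelay {f : Plane → ℝ} {x : Plane} (hx : x ∈ lensPlane f) (y : Plane) :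
    (hessian (timeDelay f y) x).det = jacDet f x := by
  rw [jacDet_eq (contDiffAt_of_mem_lensPlane hx), Matrix.det_fin_two]
  simp [hessian, partialDeriv₂_timeDelay hx]

/-! ### Parity and Morse index -/

/-- A symmetric `2 × 2` real matrix has two real eigenvalues `s, t` with `s * t = det`. -/
lemma exists_roots_charpoly {a b d : ℝ} :
    ∃ s t : ℝ, s * t = a * d - b * b ∧
      (Matrix.of ![![a, b], ![b, d]] : Matrix (Fin 2) (Fin 2) ℝ).charpoly.roots = {s, t} := by
  have hdisc : 0 ≤ (a - d) ^ 2 + 4 * b ^ 2 := by positivity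
  set q := √((a - d) ^ 2 + 4 * b ^ 2) with hq
  have hqq : q * q = (a - d) ^ 2 + 4 * b ^ 2 := Real.mul_self_sqrt hdisc
  refine ⟨(a + d + q) / 2, (a + d - q) / 2, by nlinarith, ?_⟩
  have : (Matrix.of ![![a, b], ![b, d]] : Matrix (Fin 2) (Fin 2) ℝ).charpoly =
      (Polynomial.X - Polynomial.C ((a + d + q) / 2)) *
        (Polynomial.X - Polynomial.C ((a + d - q) / 2)) := by
    have e1 : a + d = (a + d + q) / 2 + (a + d - q) / 2 := by ring
    have e2 : a * d - b * b = (a + d + q) / 2 * ((a + d - q) / 2) := by nlinarith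
    rw [Matrix.charpoly_fin_two, Matrix.trace_fin_two, Matrix.det_fin_two]
    simp only [Matrix.of_apply, Matrix.cons_val_zero, Matrix.cons_val_one]
    rw [e2]
    nth_rewrite 1 [e1]
    simp only [Polynomial.C_add, Polynomial.C_mul]
    ring
  rw [this, Polynomial.roots_mul (mul_ne_zero (Polynomial.X_sub_C_ne_zero _)
    (Polynomial.X_sub_C_ne_zero _)), Polynomial.roots_X_sub_C, Polynomial.roots_X_sub_C]
  rfl

/-- For a nondegenerate Hessian, even Morse index means positive determinant. -/
lemma morseIndex_even_iff {f : Plane → ℝ} {x : Plane}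
    (hsymm : partialDeriv₂ f 1 0 x = partialDeriv₂ f 0 1 x) (h0 : (hessian f x).det ≠ 0) :
    (morseIndex f x = 0 ∨ morseIndex f x = 2) ↔ 0 < (hessian f x).det := by
  have hH : hessian f x = Matrix.of ![![partialDeriv₂ f 0 0 x, partialDeriv₂ f 0 1 x],
      ![partialDeriv₂ f 0 1 x, partialDeriv₂ f 1 1 x]] := by
    ext i j
    fin_cases i <;> fin_cases j <;> simp [hessian, hsymm]
  obtain ⟨s, t, hst, hr⟩ := exists_roots_charpoly (a := partialDeriv₂ f 0 0 x)
    (b := partialDeriv₂ f 0 1 x) (d := partialDeriv₂ f 1 1 x)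
  have hdet : (hessian f x).det = s * t := by
    rw [hst, hH, Matrix.det_fin_two]; simp
  have hcount : morseIndex f x = (if s < 0 then 1 else 0) + (if t < 0 then 1 else 0) := by
    rw [morseIndex, hH, hr, Multiset.insert_eq_cons, Multiset.countP_cons,
      ← Multiset.cons_zero, Multiset.countP_cons, Multiset.countP_zero]
    split_ifs <;> rfl
  rw [hdet] at h0 ⊢
  rw [hcount]
  obtain ⟨hs, ht⟩ := mul_ne_zero_iff.1 h0
  rcases hs.lt_or_gt with hs | hs <;> rcases ht.lt_or_gt with ht | ht
  · simp [hs, ht, mul_pos_of_neg_of_neg]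
  · simp [hs, ht.le, (mul_neg_of_neg_of_pos hs ht).le, not_lt.2]
  · simp [hs.le, ht, (mul_neg_of_pos_of_neg hs ht).le, not_lt.2]
  · simp [hs.le, ht.le, mul_pos hs ht, not_lt.2]

/-- The part of `D` in the lens plane where the lensing map preserves orientation. -/
def positivePart (f : Plane → ℝ) (D : Set Plane) : Set Plane :=
  {x | x ∈ D ∧ x ∈ lensPlane f ∧ 0 < jacDet f x}

/-- Positive parity images are the preimages under the lensing map in the orientation
preserving part. -/
lemma numPositive_eq (f : Plane → ℝ) (D : Set Plane) (y : Plane) :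
    numPositive f D y = (positivePart f D ∩ lensMap f ⁻¹' {y}).encard := by
  have key : ∀ x, x ∈ lensPlane f → jacDet f x ≠ 0 →
      ((morseIndex (timeDelay f y) x = 0 ∨ morseIndex (timeDelay f y) x = 2) ↔
        0 < jacDet f x) := by
    intro x hx h0
    rw [← det_hessian_timeDelay hx y] at h0 ⊢
    refine morseIndex_even_iff ?_ h0
    rw [partialDeriv₂_timeDelay hx, partialDeriv₂_timeDelay hx,
      partialDeriv₂_comm (contDiffAt_of_mem_lensPlane hx)]
    simp
  rw [numPositive, ← Set.encard_union_eq]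
  · congr 1
    ext x
    simp only [IsMinImage, IsMaxImage, IsNondegenerateImage, isLensedImage_iff, positivePart,
      mem_union, mem_ofPred_eq, mem_inter_iff, mem_preimage, mem_singleton_iff]
    constructor
    · rintro (⟨hD, ⟨⟨hx, hy⟩, h0⟩, hm⟩ | ⟨hD, ⟨⟨hx, hy⟩, h0⟩, hm⟩)
      · rw [det_hessian_timeDelay hx] at h0
        exact ⟨⟨hD, hx, (key x hx h0).1 (Or.inl hm)⟩, hy⟩
      · rw [det_hessian_timeDelay hx] at h0
        exact ⟨⟨hD, hx, (key x hx h0).1 (Or.inr hm)⟩, hy⟩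
    · rintro ⟨⟨hD, hx, h⟩, hy⟩
      have h0 : (hessian (timeDelay f y) x).det ≠ 0 := by
        rw [det_hessian_timeDelay hx]; exact h.ne'
      rcases (key x hx h.ne').2 h with hm | hm
      · exact Or.inl ⟨hD, ⟨⟨hx, hy⟩, h0⟩, hm⟩
      · exact Or.inr ⟨hD, ⟨⟨hx, hy⟩, h0⟩, hm⟩
  · rw [Set.disjoint_left]
    rintro x ⟨-, -, h1⟩ ⟨-, -, h2⟩
    omega


/-! ### Change of variables with multiplicity -/

section AreaFormula

variable {E : Type*} [NormedAddCommGroup E] [NormedSpace ℝ E] [FiniteDimensional ℝ E]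
  [MeasurableSpace E] [BorelSpace E]

/-- Each linear approximation being invertible, the differentiable map `f` is injective on the
pieces of a countable measurable partition of `s`. -/
lemma exists_partition_injOn {f : E → E} {s : Set E} {f' : E → E →L[ℝ] E}
    (hf' : ∀ x ∈ s, HasFDerivWithinAt f (f' x) s x) (hdet : ∀ x ∈ s, (f' x).det ≠ 0) :
    ∃ t : ℕ → Set E, Pairwise (fun i j => Disjoint (t i) (t j)) ∧ (∀ n, MeasurableSet (t n)) ∧
      s ⊆ ⋃ n, t n ∧ ∀ n, InjOn f (s ∩ t n) := by
  have hr : ∀ A : E →L[ℝ] E, ∃ r : NNReal, r ≠ 0 ∧ (A.det ≠ 0 → ∀ u : Set E,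
      ApproximatesLinearOn f A u r → InjOn f u) := by
    intro A
    by_cases hA : A.det = 0
    · exact ⟨1, one_ne_zero, fun h => absurd hA h⟩
    let B := A.toContinuousLinearEquivOfDetNeZero hA
    have hB : (B : E →L[ℝ] E) = A := by ext; simp [B]
    rcases subsingleton_or_nontrivial E with hE | hE
    · exact ⟨1, one_ne_zero, fun _ u _ => injOn_of_injective (Function.injective_of_subsingleton f)⟩
    have hpos : 0 < ‖(B.symm : E →L[ℝ] E)‖₊⁻¹ := by
      rw [inv_pos]; exact B.nnnorm_symm_pos
    obtain ⟨r, hr0, hr1⟩ := exists_between hpos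
    refine ⟨r, hr0.ne', fun _ u hu => ?_⟩
    rw [← hB] at hu
    exact hu.injOn (Or.inr hr1)
  choose r hr0 hr using hr
  obtain ⟨t, A, hdisj, hmeas, hcov, happ, hA⟩ :=
    exists_partition_approximatesLinearOn_of_hasFDerivWithinAt f s f' hf' r hr0
  refine ⟨t, hdisj, hmeas, hcov, fun n => ?_⟩
  rcases s.eq_empty_or_nonempty with rfl | hne
  · simp
  obtain ⟨y, hy, hAy⟩ := hA hne n
  exact hr (A n) (hAy ▸ hdet y hy) _ (happ n)

/-- The area formula for maps with invertible derivative: the Jacobian integrates to the number of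
preimages. -/
lemma setLIntegral_encard_preimage (μ : Measure E) [μ.IsAddHaarMeasure]
    {f : E → E} {s : Set E} {f' : E → E →L[ℝ] E} (hs : MeasurableSet s)
    (hf' : ∀ x ∈ s, HasFDerivWithinAt f (f' x) s x) (hdet : ∀ x ∈ s, (f' x).det ≠ 0)
    {B : Set E} (hB : MeasurableSet B) :
    ∫⁻ y in B, ((s ∩ f ⁻¹' {y}).encard : ℝ≥0∞) ∂μ =
      ∫⁻ x in s, ENNReal.ofReal |(f' x).det| * B.indicator 1 (f x) ∂μ := by
  obtain ⟨t, hdisj, hmeas, hcov, hinj⟩ := exists_partition_injOn hf' hdet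
  have hf'' : ∀ n, ∀ x ∈ s ∩ t n, HasFDerivWithinAt f (f' x) (s ∩ t n) x := fun n x hx =>
    (hf' x hx.1).mono inter_subset_left
  have hsu : s = ⋃ n, s ∩ t n := by rw [← inter_iUnion, inter_eq_left.2 hcov]
  have hm : ∀ n, MeasurableSet (f '' (s ∩ t n)) := fun n =>
    measurable_image_of_fderivWithin (hs.inter (hmeas n)) (hf'' n) (hinj n)
  -- the number of preimages is the number of pieces whose image contains the point
  have hcount : ∀ y, ((s ∩ f ⁻¹' {y}).encard : ℝ≥0∞) =
      ∑' n, (f '' (s ∩ t n)).indicator (fun _ => (1 : ℝ≥0∞)) y := by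
    intro y
    have hsub : ∀ n, ((s ∩ t n) ∩ f ⁻¹' {y}).Subsingleton := fun n a ha b hb =>
      hinj n ha.1 hb.1 (ha.2.trans hb.2.symm)
    have hU : s ∩ f ⁻¹' {y} = ⋃ n, (s ∩ t n) ∩ f ⁻¹' {y} := by
      rw [← iUnion_inter, ← hsu]
    have hUm : MeasurableSet (s ∩ f ⁻¹' {y}) := by
      rw [hU]; exact MeasurableSet.iUnion fun n => (hsub n).measurableSet
    rw [← Measure.count_apply hUm, hU, measure_iUnion
      (fun i j hij => ((hdisj hij).mono inter_subset_right inter_subset_right).mono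
        inter_subset_left inter_subset_left) (fun n => (hsub n).measurableSet)]
    refine tsum_congr fun n => ?_
    rcases (hsub n).eq_empty_or_singleton with h | ⟨a, ha⟩
    · rw [h, measure_empty, indicator_of_notMem]
      rintro ⟨x, hx, hxy⟩
      have hmem : x ∈ (s ∩ t n) ∩ f ⁻¹' {y} := ⟨hx, hxy⟩
      rw [h] at hmem
      exact hmem
    · have hmem : a ∈ (s ∩ t n) ∩ f ⁻¹' {y} := ha ▸ mem_singleton a
      rw [ha, Measure.count_singleton, 
        indicator_of_mem (show y ∈ f '' (s ∩ t n) from ⟨a, hmem.1, hmem.2⟩)]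
  calc ∫⁻ y in B, ((s ∩ f ⁻¹' {y}).encard : ℝ≥0∞) ∂μ
      = ∑' n, ∫⁻ y in B, (f '' (s ∩ t n)).indicator (fun _ => (1 : ℝ≥0∞)) y ∂μ := by
        simp_rw [hcount]
        exact lintegral_tsum fun n => (measurable_const.indicator (hm n)).aemeasurable
    _ = ∑' n, ∫⁻ y in f '' (s ∩ t n), B.indicator 1 y ∂μ := by
        refine tsum_congr fun n => ?_
        rw [lintegral_indicator_const (hm n), lintegral_indicator_one hB,
          Measure.restrict_apply (hm n), Measure.restrict_apply hB, one_mul, inter_comm]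
    _ = ∑' n, ∫⁻ x in s ∩ t n, ENNReal.ofReal |(f' x).det| * B.indicator 1 (f x) ∂μ :=
        tsum_congr fun n => lintegral_image_eq_lintegral_abs_det_fderiv_mul μ
          (hs.inter (hmeas n)) (hf'' n) (hinj n) _
    _ = ∫⁻ x in s, ENNReal.ofReal |(f' x).det| * B.indicator 1 (f x) ∂μ := by
        conv_rhs => rw [hsu]
        rw [lintegral_iUnion (fun n => hs.inter (hmeas n))
          (fun i j hij => (hdisj hij).mono inter_subset_right inter_subset_right)]

end AreaFormula

/-! ### Measurability of random sets and of their cardinality -/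

/-- The cardinality of a random set is measurable as soon as the events that it meets a given open
set are: it is at least `n` when the set meets `n` disjoint basic open sets. -/
lemma measurable_encard_of_inter_open {α X : Type*} [MeasurableSpace α] [TopologicalSpace X]
    [T2Space X] [SecondCountableTopology X] {S : α → Set X}
    (hS : ∀ U, IsOpen U → MeasurableSet {a | (S a ∩ U).Nonempty}) :
    Measurable fun a => ((S a).encard : ℝ≥0∞) := by
  obtain ⟨b, hbc, -, hb⟩ := TopologicalSpace.exists_countable_basis X
  have := hbc.to_subtype
  let T : (n : ℕ) → (Fin n → b) → Set α := fun n u =>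
    {a | Pairwise (fun i j => Disjoint (u i : Set X) (u j)) ∧ ∀ i, (S a ∩ u i).Nonempty}
  have hT : ∀ n u, MeasurableSet (T n u) := by
    intro n u
    have hTu : T n u = {_a | Pairwise (fun i j => Disjoint (u i : Set X) (u j))} ∩
        ⋂ i, {a | (S a ∩ (u i : Set X)).Nonempty} := by ext; simp [T]
    rw [hTu]
    exact (MeasurableSet.const _).inter (MeasurableSet.iInter fun i => hS _ (hb.isOpen (u i).2))
  have key : (fun a => ((S a).encard : ℝ≥0∞)) =
      fun a => ⨆ n : ℕ, ⨆ u : Fin n → b, (T n u).indicator (fun _ => (n : ℝ≥0∞)) a := by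
    ext a
    apply le_antisymm
    · -- every finite subset is separated by disjoint basic open sets
      have hle : ∀ n : ℕ, (n : ℕ∞) ≤ (S a).encard → (n : ℝ≥0∞) ≤
          ⨆ n : ℕ, ⨆ u : Fin n → b, (T n u).indicator (fun _ => (n : ℝ≥0∞)) a := by
        intro n hn
        obtain ⟨F, hFS, hF⟩ := Set.exists_subset_encard_eq hn
        have hFf : F.Finite := Set.finite_of_encard_eq_coe hF
        obtain ⟨V, hV, hVd⟩ := hFf.t2_separation
        have hcard : Nat.card F = n := by
          have : F.ncard = n := by rw [Set.ncard_def, hF]; rfl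
          simpa [Set.ncard] using this
        have := hFf.to_subtype
        let e : Fin n ≃ F := (Finite.equivFinOfCardEq hcard).symm
        choose! w hwb hxw hwV using fun x => hb.exists_subset_of_mem_open (hV x).1 (hV x).2
        let u : Fin n → b := fun i => ⟨w (e i), hwb _⟩
        have hu : a ∈ T n u := by
          refine ⟨fun i j hij => ?_, fun i => ⟨e i, hFS (e i).2, hxw _⟩⟩
          have hne : (e i : X) ≠ e j := fun h => hij (e.injective (Subtype.ext h))
          exact (hVd (e i).2 (e j).2 hne).mono (hwV _) (hwV _)
        refine le_iSup_of_le n (le_iSup_of_le u ?_)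
        rw [indicator_of_mem hu]
      refine le_of_forall_lt fun c hc => ?_
      rcases eq_or_ne (S a).encard ⊤ with h | h
      · rw [h] at hc
        obtain ⟨n, hn⟩ := ENNReal.exists_nat_gt (r := c) (by simpa using hc.ne)
        exact hn.trans_le (hle n (by simp [h]))
      · obtain ⟨n, hn⟩ := ENat.ne_top_iff_exists.1 h
        refine hc.trans_le ?_
        rw [← hn]
        exact_mod_cast hle n hn.le
    · refine iSup_le fun n => iSup_le fun u => ?_
      by_cases ha : a ∈ T n u
      swap
      · simp [indicator_of_notMem ha]
      rw [indicator_of_mem ha]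
      obtain ⟨hd, hne⟩ := ha
      choose x hxS hxu using hne
      have hinj : Function.Injective x := fun i j hij => by
        by_contra h
        exact Set.disjoint_left.1 (hd h) (hxu i) (hij ▸ hxu j)
      have h1 : (n : ℕ∞) ≤ (S a).encard := by
        calc (n : ℕ∞) = (Set.range x).encard := by
              rw [← image_univ, hinj.encard_image, encard_univ]; simp
          _ ≤ (S a).encard := encard_le_encard (by rintro _ ⟨i, rfl⟩; exact hxS i)
      exact_mod_cast (ENat.toENNReal_le.2 h1)
  rw [key]
  exact Measurable.iSup fun n => Measurable.iSup fun u => measurable_const.indicator (hT n u)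

/-- A nonnegative random function that is continuous on a compact set `K` on the event `A` has a
zero in `K` exactly when its values on a countable dense subset are arbitrarily small. -/
lemma measurableSet_exists_zero {α X : Type*} [MeasurableSpace α] [PseudoMetricSpace X]
    {K : Set X} (hK : IsCompact K) {A : Set α} (hA : MeasurableSet A) {h : α → X → ℝ}
    (h0 : ∀ a ∈ A, ∀ x ∈ K, 0 ≤ h a x) (hm : ∀ x ∈ K, Measurable fun a => h a x)
    (hc : ∀ a ∈ A, ContinuousOn (h a) K) :
    MeasurableSet {a | a ∈ A ∧ ∃ x ∈ K, h a x = 0} := by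
  obtain ⟨Q, hQK, hQc, hQ⟩ := hK.isSeparable.exists_countable_dense_subset
  have key : {a | a ∈ A ∧ ∃ x ∈ K, h a x = 0} =
      A ∩ ⋂ n : ℕ, ⋃ x ∈ Q, {a | h a x < 1 / ((n : ℝ) + 1)} := by
    ext a
    simp only [mem_ofPred_eq, mem_inter_iff, mem_iInter, mem_iUnion, exists_prop]
    refine and_congr_right fun ha => ⟨?_, fun H => ?_⟩
    · rintro ⟨x, hx, hax⟩ n
      have hpos : h a x < 1 / ((n : ℝ) + 1) := by rw [hax]; positivity
      have hn : ∀ᶠ z in 𝓝[K] x, h a z < 1 / ((n : ℝ) + 1) :=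
        (hc a ha x hx).eventually (eventually_lt_nhds hpos)
      obtain ⟨O, hO, hxO, hsub⟩ := mem_nhdsWithin.1 hn
      obtain ⟨z, hzO, hzQ⟩ := mem_closure_iff.1 (hQ hx) O hO hxO
      exact ⟨z, hzQ, hsub ⟨hzO, hQK hzQ⟩⟩
    · obtain ⟨x₁, hx₁, -⟩ := H 0
      obtain ⟨x, hx, hmin⟩ := hK.exists_isMinOn ⟨x₁, hQK hx₁⟩ (hc a ha)
      refine ⟨x, hx, le_antisymm (le_of_forall_pos_lt_add fun ε hε => ?_) (h0 a ha x hx)⟩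
      obtain ⟨n, hn⟩ := exists_nat_one_div_lt hε
      obtain ⟨z, hz, hlt⟩ := H n
      have := hmin (hQK hz)
      rw [zero_add]
      exact (this.trans_lt hlt).trans hn
  rw [key]
  exact hA.inter (MeasurableSet.iInter fun n => MeasurableSet.biUnion hQc fun x hx =>
    measurableSet_lt (hm x (hQK hx)) measurable_const)


/-! ### Joint measurability of the random lens -/

section JointMeasurability

variable {Ω : Type*} {ψ : Ω → Plane → ℝ}

/-- The pairs `(ω, x)` with `x` in the lens plane of `ψ ω`. -/
def lensSet (ψ : Ω → Plane → ℝ) : Set (Ω × Plane) :=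
  {p | p.2 ∈ lensPlane (ψ p.1)}

/-- The lensing map as a jointly measurable field, set to `0` off the lens plane. -/
def lensField (ψ : Ω → Plane → ℝ) : Ω × Plane → Plane :=
  (lensSet ψ).indicator fun p => lensMap (ψ p.1) p.2

/-- The Jacobian determinant of the lensing map as a jointly measurable field, set to `0` off the
lens plane. -/
def jacField (ψ : Ω → Plane → ℝ) : Ω × Plane → ℝ :=
  (lensSet ψ).indicator fun p => jacDet (ψ p.1) p.2

lemma lensField_of_mem {p : Ω × Plane} (hp : p ∈ lensSet ψ) :
    lensField ψ p = lensMap (ψ p.1) p.2 := indicator_of_mem hp _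

lemma jacField_of_mem {p : Ω × Plane} (hp : p ∈ lensSet ψ) :
    jacField ψ p = jacDet (ψ p.1) p.2 := indicator_of_mem hp _

lemma jacField_of_notMem {p : Ω × Plane} (hp : p ∉ lensSet ψ) :
    jacField ψ p = 0 := indicator_of_notMem hp _

lemma positivePart_eq (ψ : Ω → Plane → ℝ) (D : Set Plane) (ω : Ω) :
    positivePart (ψ ω) D = D ∩ {x | 0 < jacField ψ (ω, x)} := by
  ext x
  by_cases hx : (ω, x) ∈ lensSet ψ
  · have hx' : x ∈ lensPlane (ψ ω) := hx
    simp [positivePart, jacField_of_mem hx, hx']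
  · have hx' : x ∉ lensPlane (ψ ω) := hx
    simp [positivePart, jacField_of_notMem hx, hx']

variable [MeasurableSpace Ω] {P : Measure Ω}

lemma measurableSet_subset_lensPlane (hψ : IsRandomPotential P ψ) {U : Set Plane}
    (hU : IsOpen U) : MeasurableSet {ω | U ⊆ lensPlane (ψ ω)} := by
  have h : {ω | U ⊆ lensPlane (ψ ω)} = {ω | ((lensPlane (ψ ω))ᶜ ∩ U).Nonempty}ᶜ := by
    ext ω
    simp only [mem_ofPred_eq, mem_compl_iff, not_nonempty_iff_eq_empty]
    rw [inter_comm, ← sdiff_eq, sdiff_eq_empty]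
  rw [h]
  exact (hψ.measurable_singular U hU).compl

lemma measurableSet_lensSet (hψ : IsRandomPotential P ψ) : MeasurableSet (lensSet ψ) := by
  obtain ⟨b, hbc, -, hb⟩ := TopologicalSpace.exists_countable_basis Plane
  have h : lensSet ψ = ⋃ U ∈ b, {ω | U ⊆ lensPlane (ψ ω)} ×ˢ U := by
    ext ⟨ω, x⟩
    simp only [lensSet, mem_ofPred_eq, mem_iUnion, mem_prod, exists_prop]
    constructor
    · intro hx
      obtain ⟨U, hU, hxU, hsub⟩ := hb.exists_subset_of_mem_open hx (isOpen_lensPlane (ψ ω))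
      exact ⟨U, hU, hsub, hxU⟩
    · rintro ⟨U, -, hsub, hxU⟩
      exact hsub hxU
  rw [h]
  exact MeasurableSet.biUnion hbc fun U hU =>
    (measurableSet_subset_lensPlane hψ (hb.isOpen hU)).prod (hb.isOpen hU).measurableSet

/-- A field that is measurable at each point and continuous on the lens plane is jointly
measurable there. -/
lemma measurable_indicator_of_continuousAt (hψ : IsRandomPotential P ψ) {u : Ω → Plane → ℝ}
    (hm : ∀ x, Measurable fun ω => u ω x)
    (hc : ∀ ω, ∀ x ∈ lensPlane (ψ ω), ContinuousAt (u ω) x) :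
    Measurable ((lensSet ψ).indicator fun p => u p.1 p.2) := by
  have hid : StronglyMeasurable (id : Plane → Plane) := stronglyMeasurable_id
  have hU : ∀ n, Measurable ((lensSet ψ).indicator fun p => u p.1 (hid.approx n p.2)) := by
    intro n
    refine Measurable.indicator ?_ (measurableSet_lensSet hψ)
    have h1 : Measurable fun q : Ω × (hid.approx n).range => u q.1 q.2 :=
      measurable_from_prod_countable_left fun q => hm q
    exact h1.comp (measurable_fst.prodMk (((hid.approx n).measurable.comp measurable_snd).subtype_mk
      (h := fun p => SimpleFunc.mem_range_self _ p.2)))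
  refine measurable_of_tendsto_metrizable hU (tendsto_pi_nhds.2 fun p => ?_)
  by_cases hp : p ∈ lensSet ψ
  · simp only [indicator_of_mem hp]
    exact (hc p.1 p.2 hp).tendsto.comp (hid.tendsto_approx p.2)
  · simp only [indicator_of_notMem hp]
    exact tendsto_const_nhds

/-- Directional derivatives are limits of difference quotients, taken inside the lens plane. -/
lemma measurable_indicator_fderiv (hψ : IsRandomPotential P ψ) {u : Ω → Plane → ℝ}
    (hm : Measurable ((lensSet ψ).indicator fun p => u p.1 p.2))
    (hd : ∀ ω, ∀ x ∈ lensPlane (ψ ω), DifferentiableAt ℝ (u ω) x) (v : Plane) :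
    Measurable ((lensSet ψ).indicator fun p => fderiv ℝ (u p.1) p.2 v) := by
  let w : Ω × Plane → ℝ := (lensSet ψ).indicator fun p => u p.1 p.2
  have hU : ∀ n : ℕ, Measurable ((lensSet ψ).indicator fun p =>
      (n : ℝ) • (w (p.1, p.2 + (n : ℝ)⁻¹ • v) - w p)) := by
    intro n
    refine Measurable.indicator ?_ (measurableSet_lensSet hψ)
    have hshift : Measurable fun p : Ω × Plane => (p.1, p.2 + (n : ℝ)⁻¹ • v) :=
      measurable_fst.prodMk (measurable_snd.add_const _)
    exact ((hm.comp hshift).sub hm).const_smul (n : ℝ)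
  refine measurable_of_tendsto_metrizable hU (tendsto_pi_nhds.2 fun p => ?_)
  by_cases hp : p ∈ lensSet ψ
  swap
  · simp only [indicator_of_notMem hp]
    exact tendsto_const_nhds
  simp only [indicator_of_mem hp]
  have hlim := (hd p.1 p.2 hp).hasFDerivAt.lim v (c := fun n : ℕ => (n : ℝ)) (l := atTop)
    (by simpa using tendsto_natCast_atTop_atTop)
  refine hlim.congr' ?_
  have hto : Tendsto (fun n : ℕ => p.2 + (n : ℝ)⁻¹ • v) atTop (𝓝 p.2) := by
    have := (tendsto_inv_atTop_nhds_zero_nat (𝕜 := ℝ)).smul_const v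
    simpa using this.const_add p.2
  filter_upwards [hto.eventually ((isOpen_lensPlane (ψ p.1)).mem_nhds hp)] with n hn
  have h1 : w (p.1, p.2 + (n : ℝ)⁻¹ • v) = u p.1 (p.2 + (n : ℝ)⁻¹ • v) :=
    indicator_of_mem (s := lensSet ψ) hn _
  have h2 : w p = u p.1 p.2 := indicator_of_mem hp _
  rw [h1, h2]

lemma measurable_indicator_partialDeriv (hψ : IsRandomPotential P ψ) (i : Fin 2) :
    Measurable ((lensSet ψ).indicator fun p => partialDeriv (ψ p.1) i p.2) :=
  measurable_indicator_fderiv hψ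
    (measurable_indicator_of_continuousAt hψ hψ.measurable_eval fun _ _ hx =>
      (contDiffAt_of_mem_lensPlane hx).continuousAt)
    (fun _ _ hx => (contDiffAt_of_mem_lensPlane hx).differentiableAt (by simp)) _

lemma measurable_indicator_partialDeriv₂ (hψ : IsRandomPotential P ψ) (i j : Fin 2) :
    Measurable ((lensSet ψ).indicator fun p => partialDeriv₂ (ψ p.1) i j p.2) :=
  measurable_indicator_fderiv (u := fun ω => partialDeriv (ψ ω) j) hψ
    (measurable_indicator_partialDeriv hψ j)
    (fun _ _ hx => (contDiffAt_partialDeriv (contDiffAt_of_mem_lensPlane hx) j).differentiableAt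
      (by simp)) _

lemma measurable_lensField (hψ : IsRandomPotential P ψ) : Measurable (lensField ψ) := by
  have h : lensField ψ = fun p => WithLp.toLp 2 fun i => (lensSet ψ).indicator (fun p => p.2 i) p -
      (lensSet ψ).indicator (fun p => partialDeriv (ψ p.1) i p.2) p := by
    ext p i
    by_cases hp : p ∈ lensSet ψ
    · simp [lensField_of_mem hp, indicator_of_mem hp, lensMap_apply]
    · simp [lensField, indicator_of_notMem hp]
  rw [h]
  refine (MeasurableEquiv.toLp 2 (Fin 2 → ℝ)).measurable.comp (measurable_pi_lambda _ fun i => ?_)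
  refine Measurable.sub (Measurable.indicator ?_ (measurableSet_lensSet hψ))
    (measurable_indicator_partialDeriv hψ i)
  exact (EuclideanSpace.proj i : Plane →L[ℝ] ℝ).measurable.comp measurable_snd

lemma measurable_jacField (hψ : IsRandomPotential P ψ) : Measurable (jacField ψ) := by
  let d : Fin 2 → Fin 2 → Ω × Plane → ℝ := fun i j =>
    (lensSet ψ).indicator fun p => partialDeriv₂ (ψ p.1) i j p.2
  have hd : ∀ i j, Measurable (d i j) := fun i j => measurable_indicator_partialDeriv₂ hψ i j
  have h : jacField ψ = (lensSet ψ).indicator fun p =>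
      (1 - d 0 0 p) * (1 - d 1 1 p) - d 0 1 p * d 1 0 p := by
    refine indicator_congr fun p hp => ?_
    simp only [d, indicator_of_mem hp, jacDet_eq (contDiffAt_of_mem_lensPlane hp)]
  rw [h]
  exact Measurable.indicator (((measurable_const.sub (hd 0 0)).mul
    (measurable_const.sub (hd 1 1))).sub ((hd 0 1).mul (hd 1 0))) (measurableSet_lensSet hψ)

lemma continuousAt_lensMap {f : Plane → ℝ} {x : Plane} (hx : x ∈ lensPlane f) :
    ContinuousAt (lensMap f) x :=
  (hasFDerivAt_lensMap (contDiffAt_of_mem_lensPlane hx)).1.continuousAt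

lemma continuousAt_jacDet {f : Plane → ℝ} {x : Plane} (hx : x ∈ lensPlane f) :
    ContinuousAt (jacDet f) x := by
  have hd : ∀ i j, ContinuousAt (partialDeriv₂ f i j) x := fun i j =>
    (contDiffAt_partialDeriv₂ (contDiffAt_of_mem_lensPlane hx) i j).continuousAt
  have he : jacDet f =ᶠ[𝓝 x] fun z => (1 - partialDeriv₂ f 0 0 z) * (1 - partialDeriv₂ f 1 1 z)
      - partialDeriv₂ f 0 1 z * partialDeriv₂ f 1 0 z :=
    Eventually.mono hx fun z hz => jacDet_eq hz
  exact (((continuousAt_const.sub (hd 0 0)).mul (continuousAt_const.sub (hd 1 1))).sub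
    ((hd 0 1).mul (hd 1 0))).congr he.symm

/-- Near each positive image the lensing map is continuous and the Jacobian bounded below, on a
compact neighbourhood taken from a countable family. -/
lemma measurableSet_positivePart_inter (hψ : IsRandomPotential P ψ) {D : Set Plane}
    (hD : IsCompact D) {U : Set Plane} (hU : IsOpen U) :
    MeasurableSet {p : Ω × Plane |
      ((positivePart (ψ p.1) D ∩ lensMap (ψ p.1) ⁻¹' {p.2}) ∩ U).Nonempty} := by
  obtain ⟨b, hbc, -, hb⟩ := TopologicalSpace.exists_countable_basis Plane
  let h : ℕ → Ω × Plane → Plane → ℝ := fun n p x =>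
    dist (lensField ψ (p.1, x)) p.2 + max 0 (1 / ((n : ℝ) + 1) - jacField ψ (p.1, x))
  have h_nonneg : ∀ n p x, 0 ≤ h n p x := fun n p x => by positivity
  have h_zero : ∀ n p x, h n p x = 0 ↔
      lensField ψ (p.1, x) = p.2 ∧ 1 / ((n : ℝ) + 1) ≤ jacField ψ (p.1, x) := by
    intro n p x
    simp only [h]
    rw [add_eq_zero_iff_of_nonneg dist_nonneg (le_max_left _ _), dist_eq_zero, max_eq_left_iff,
      sub_nonpos]
  have key : {p : Ω × Plane |
      ((positivePart (ψ p.1) D ∩ lensMap (ψ p.1) ⁻¹' {p.2}) ∩ U).Nonempty} =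
      ⋃ V ∈ b, ⋃ W ∈ b, ⋃ n : ℕ, {p | (closure V ⊆ W ∧ W ⊆ U) ∧
        p ∈ Prod.fst ⁻¹' {ω | W ⊆ lensPlane (ψ ω)} ∧ ∃ x ∈ D ∩ closure V, h n p x = 0} := by
    ext p
    simp only [mem_ofPred_eq, mem_iUnion, exists_prop, mem_preimage]
    constructor
    · rintro ⟨x, ⟨⟨hxD, hxL, hxJ⟩, hxp⟩, hxU⟩
      obtain ⟨W, hW, hxW, hWsub⟩ := hb.exists_subset_of_mem_open
        (show x ∈ lensPlane (ψ p.1) ∩ U from ⟨hxL, hxU⟩) ((isOpen_lensPlane _).inter hU)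
      obtain ⟨V, hV, hxV, hVsub⟩ := hb.exists_closure_subset ((hb.isOpen hW).mem_nhds hxW)
      obtain ⟨n, hn⟩ := exists_nat_one_div_lt hxJ
      have hmem : (p.1, x) ∈ lensSet ψ := hxL
      refine ⟨V, hV, W, hW, n, ⟨hVsub, fun z hz => (hWsub hz).2⟩, fun z hz => (hWsub hz).1, x,
        ⟨hxD, subset_closure hxV⟩, (h_zero n p x).2 ?_⟩
      rw [lensField_of_mem hmem, jacField_of_mem hmem]
      exact ⟨hxp, hn.le⟩
    · rintro ⟨V, -, W, -, n, ⟨hVW, hWU⟩, hWL, x, ⟨hxD, hxV⟩, hx0⟩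
      have hmem : (p.1, x) ∈ lensSet ψ := hWL (hVW hxV)
      rw [h_zero, lensField_of_mem hmem, jacField_of_mem hmem] at hx0
      exact ⟨x, ⟨⟨hxD, hmem, lt_of_lt_of_le (by positivity) hx0.2⟩, hx0.1⟩, hWU (hVW hxV)⟩
  rw [key]
  refine MeasurableSet.biUnion hbc fun V hV => MeasurableSet.biUnion hbc fun W hW =>
    MeasurableSet.iUnion fun n => ?_
  by_cases hVW : closure V ⊆ W ∧ W ⊆ U
  swap
  · simp [hVW]
  simp only [hVW, true_and, and_self]
  refine measurableSet_exists_zero (hD.inter_right isClosed_closure)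
    (measurable_fst (measurableSet_subset_lensPlane hψ (hb.isOpen hW)))
    (fun p _ x _ => h_nonneg n p x) (fun x _ => ?_) (fun p hp => ?_)
  · have hx : Measurable fun p : Ω × Plane => (p.1, x) := measurable_fst.prodMk measurable_const
    exact (((measurable_lensField hψ).comp hx).dist measurable_snd).add
      (measurable_const.max (measurable_const.sub ((measurable_jacField hψ).comp hx)))
  · have hp' : W ⊆ lensPlane (ψ p.1) := hp
    refine ContinuousOn.congr (f := fun x => dist (lensMap (ψ p.1) x) p.2 +
      max 0 (1 / ((n : ℝ) + 1) - jacDet (ψ p.1) x)) (fun x hx => ?_) (fun x hx => ?_)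
    · have hxL : x ∈ lensPlane (ψ p.1) := hp' (hVW.1 hx.2)
      exact ContinuousAt.continuousWithinAt (((continuousAt_lensMap hxL).dist
        continuousAt_const).add (continuousAt_const.max
          (continuousAt_const.sub (continuousAt_jacDet hxL))))
    · have hmem : (p.1, x) ∈ lensSet ψ := hp' (hVW.1 hx.2)
      simp only [h, lensField_of_mem hmem, jacField_of_mem hmem]

lemma measurable_numPositive (hψ : IsRandomPotential P ψ) {D : Set Plane} (hD : IsCompact D) :
    Measurable fun p : Ω × Plane => (numPositive (ψ p.1) D p.2 : ℝ≥0∞) := by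
  simp_rw [numPositive_eq]
  exact measurable_encard_of_inter_open fun U hU => measurableSet_positivePart_inter hψ hD hU

end JointMeasurability


/-! ### Weighted laws of a field as kernels -/

section WeightedLaw

open ProbabilityTheory

variable {Ω α β : Type*} [MeasurableSpace Ω] [MeasurableSpace α] [MeasurableSpace β]

/-- The law of `X (·, a)` under the measure with density `w (·, a)`, as a kernel in `a`. It charges
`B` with the mean of `w (·, a)` on the event `X (·, a) ∈ B`. -/
def weightedLaw (P : Measure Ω) [SFinite P] (X : Ω × α → β) (hX : Measurable X)
    (w : Ω × α → ℝ≥0∞) (hw : Measurable w) : Kernel α β where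
  toFun a := (P.withDensity fun ω => w (ω, a)).map fun ω => X (ω, a)
  measurable' := by
    refine Measure.measurable_of_measurable_coe _ fun B hB => ?_
    have hXa : ∀ a, Measurable fun ω => X (ω, a) := fun a => hX.comp measurable_prodMk_right
    have h : ∀ a, (P.withDensity fun ω => w (ω, a)).map (fun ω => X (ω, a)) B =
        ∫⁻ ω, w (ω, a) * B.indicator 1 (X (ω, a)) ∂P := by
      intro a
      rw [Measure.map_apply (hXa a) hB, withDensity_apply _ (hXa a hB),
        ← lintegral_indicator (hXa a hB)]
      refine lintegral_congr fun ω => ?_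
      by_cases hω : X (ω, a) ∈ B <;> simp [indicator, hω]
    simp_rw [h]
    exact (hw.mul ((measurable_one.indicator hB).comp hX)).lintegral_prod_left'

variable {P : Measure Ω} [SFinite P] {X : Ω × α → β} {hX : Measurable X}
  {w : Ω × α → ℝ≥0∞} {hw : Measurable w}

lemma weightedLaw_apply (a : α) : weightedLaw P X hX w hw a =
    (P.withDensity fun ω => w (ω, a)).map fun ω => X (ω, a) := rfl

lemma weightedLaw_apply_eq_setLIntegral (a : α) {B : Set β} (hB : MeasurableSet B) :
    weightedLaw P X hX w hw a B = ∫⁻ ω in (fun ω => X (ω, a)) ⁻¹' B, w (ω, a) ∂P := by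
  have hXa : Measurable fun ω => X (ω, a) := hX.comp measurable_prodMk_right
  rw [weightedLaw_apply, Measure.map_apply hXa hB, withDensity_apply _ (hXa hB)]

lemma weightedLaw_apply_eq_lintegral (a : α) {B : Set β} (hB : MeasurableSet B) :
    weightedLaw P X hX w hw a B = ∫⁻ ω, w (ω, a) * B.indicator 1 (X (ω, a)) ∂P := by
  have hXa : Measurable fun ω => X (ω, a) := hX.comp measurable_prodMk_right
  rw [weightedLaw_apply_eq_setLIntegral a hB, ← lintegral_indicator (hXa hB)]
  refine lintegral_congr fun ω => ?_
  by_cases hω : X (ω, a) ∈ B <;> simp [indicator, hω]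

lemma weightedLaw_one (a : α) : weightedLaw P X hX 1 measurable_one a =
    P.map fun ω => X (ω, a) := by
  rw [weightedLaw_apply]
  congr 1
  exact withDensity_one

lemma weightedLaw_absolutelyContinuous (a : α) :
    weightedLaw P X hX w hw a ≪ weightedLaw P X hX 1 measurable_one a := by
  rw [weightedLaw_one, weightedLaw_apply]
  exact (withDensity_absolutelyContinuous _ _).map (hX.comp measurable_prodMk_right)

lemma isFiniteKernel_weightedLaw [IsProbabilityMeasure P] {C : ℝ≥0∞} (hC : C ≠ ∞)
    (hwC : ∀ a, ∀ᵐ ω ∂P, w (ω, a) ≤ C) : IsFiniteKernel (weightedLaw P X hX w hw) := by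
  refine ⟨⟨C, hC.lt_top, fun a => ?_⟩⟩
  rw [weightedLaw_apply_eq_setLIntegral a MeasurableSet.univ, preimage_univ, setLIntegral_univ]
  calc ∫⁻ ω, w (ω, a) ∂P ≤ ∫⁻ _, C ∂P := lintegral_mono_ae (hwC a)
    _ = C := by simp

end WeightedLaw

/-! ### The expected number of images as a weighted law -/

section ExpectedNumber

open ProbabilityTheory

variable {Ω : Type*} [MeasurableSpace Ω] {P : Measure Ω} {ψ : Ω → Plane → ℝ}

/-- The area formula for one realization of the lens. -/
lemma setLIntegral_numPositive (hψ : IsRandomPotential P ψ) {D : Set Plane}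
    (hD : MeasurableSet D) (ω : Ω) {B : Set Plane} (hB : MeasurableSet B) :
    ∫⁻ y in B, (numPositive (ψ ω) D y : ℝ≥0∞) =
      ∫⁻ x in D, ENNReal.ofReal (jacField ψ (ω, x)) * B.indicator 1 (lensField ψ (ω, x)) := by
  have hA : MeasurableSet {x | 0 < jacField ψ (ω, x)} :=
    measurableSet_lt measurable_const ((measurable_jacField hψ).comp measurable_prodMk_left)
  have hs : MeasurableSet (positivePart (ψ ω) D) := by
    rw [positivePart_eq]; exact hD.inter hA
  have harea := setLIntegral_encard_preimage volume hs (f := lensMap (ψ ω))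
    (f' := fderiv ℝ (lensMap (ψ ω))) (fun x hx =>
      (hasFDerivAt_lensMap (contDiffAt_of_mem_lensPlane hx.2.1)).1.hasFDerivWithinAt)
    (fun x hx => hx.2.2.ne') hB
  simp_rw [numPositive_eq]
  rw [harea, ← lintegral_indicator hs, ← lintegral_indicator hD]
  refine lintegral_congr fun x => ?_
  by_cases hxD : x ∈ D
  · by_cases hx : 0 < jacField ψ (ω, x)
    · have hxs : x ∈ positivePart (ψ ω) D := by rw [positivePart_eq]; exact ⟨hxD, hx⟩
      have hxL : (ω, x) ∈ lensSet ψ := hxs.2.1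
      rw [indicator_of_mem hxs, indicator_of_mem hxD, jacField_of_mem hxL, lensField_of_mem hxL]
      rw [show (fderiv ℝ (lensMap (ψ ω)) x).det = jacDet (ψ ω) x from rfl, abs_of_pos hxs.2.2]
    · have hxs : x ∉ positivePart (ψ ω) D := by rw [positivePart_eq]; exact fun h => hx h.2
      rw [indicator_of_notMem hxs, indicator_of_mem hxD, ENNReal.ofReal_of_nonpos (not_lt.1 hx),
        zero_mul]
  · rw [indicator_of_notMem (fun h => hxD h.1), indicator_of_notMem hxD]

lemma measurable_expectedPositive [SFinite P] (hψ : IsRandomPotential P ψ) {D : Set Plane}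
    (hD : IsCompact D) : Measurable (expectedPositive P ψ D) :=
  (measurable_numPositive hψ hD).lintegral_prod_left'

/-- The law of `η(x)` under the measure with density `det (Jac η)(x)⁺`. -/
def jacLaw (P : Measure Ω) [SFinite P] (ψ : Ω → Plane → ℝ) (hψ : IsRandomPotential P ψ) :
    Kernel Plane Plane :=
  weightedLaw P (lensField ψ) (measurable_lensField hψ)
    (fun p => ENNReal.ofReal (jacField ψ p)) (measurable_jacField hψ).ennreal_ofReal

/-- The law of `η(x)`. -/
def lensLaw (P : Measure Ω) [SFinite P] (ψ : Ω → Plane → ℝ) (hψ : IsRandomPotential P ψ) :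
    Kernel Plane Plane :=
  weightedLaw P (lensField ψ) (measurable_lensField hψ) 1 measurable_one

lemma setLIntegral_expectedPositive [SFinite P] (hψ : IsRandomPotential P ψ) {D : Set Plane}
    (hD : IsCompact D) {B : Set Plane} (hB : MeasurableSet B) :
    ∫⁻ y in B, expectedPositive P ψ D y = ∫⁻ x in D, jacLaw P ψ hψ x B := by
  have h1 : ∫⁻ y in B, expectedPositive P ψ D y =
      ∫⁻ ω, (∫⁻ y in B, (numPositive (ψ ω) D y : ℝ≥0∞)) ∂P :=
    lintegral_lintegral_swap
      (((measurable_numPositive hψ hD).comp measurable_swap).aemeasurable)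
  have h2 : Measurable fun p : Ω × Plane =>
      ENNReal.ofReal (jacField ψ p) * B.indicator 1 (lensField ψ p) :=
    (measurable_jacField hψ).ennreal_ofReal.mul
      ((measurable_one.indicator hB).comp (measurable_lensField hψ))
  rw [h1]
  simp_rw [setLIntegral_numPositive hψ hD.measurableSet _ hB, jacLaw,
    weightedLaw_apply_eq_lintegral _ hB]
  exact lintegral_lintegral_swap h2.aemeasurable

/-- Almost every point lies almost surely in the lens plane. -/
lemma ae_ae_mem_lensSet [SFinite P] (hψ : IsRandomPotential P ψ) :
    ∀ᵐ x : Plane, ∀ᵐ ω ∂P, (ω, x) ∈ lensSet ψ := by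
  rw [Measure.ae_ae_comm (p := fun x ω => (ω, x) ∈ lensSet ψ)
    (measurable_swap (measurableSet_lensSet hψ))]
  filter_upwards [hψ.ae_null] with ω hω
  exact hω

/-- A bound on the convergence bounds the Jacobian from above. -/
lemma ae_jacField_le {K : ℝ} (hκ : ∀ᵐ ω ∂P, ∀ x ∈ lensPlane (ψ ω), |convergence (ψ ω) x| ≤ K) :
    ∀ᵐ ω ∂P, ∀ x, jacField ψ (ω, x) ≤ (1 + K) ^ 2 := by
  filter_upwards [hκ] with ω hω x
  by_cases hx : (ω, x) ∈ lensSet ψ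
  · have hb := abs_le.1 (hω x hx)
    have hs : 0 ≤ shearSq (ψ ω) x := by rw [shearSq]; positivity
    rw [jacField_of_mem hx, jacDet_eq_convergence_shear (contDiffAt_of_mem_lensPlane hx)]
    have : (1 - convergence (ψ ω) x) ^ 2 ≤ (1 + K) ^ 2 :=
      sq_le_sq' (by linarith) (by linarith)
    dsimp only
    linarith
  · rw [jacField_of_notMem hx]; positivity

lemma isFiniteKernel_jacLaw [IsProbabilityMeasure P] (hψ : IsRandomPotential P ψ) {K : ℝ}
    (hκ : ∀ᵐ ω ∂P, ∀ x ∈ lensPlane (ψ ω), |convergence (ψ ω) x| ≤ K) :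
    IsFiniteKernel (jacLaw P ψ hψ) :=
  isFiniteKernel_weightedLaw (C := ENNReal.ofReal ((1 + K) ^ 2)) ENNReal.ofReal_ne_top fun x => by
    filter_upwards [ae_jacField_le hκ] with ω hω
    exact ENNReal.ofReal_le_ofReal (hω x)

lemma isFiniteKernel_lensLaw [IsProbabilityMeasure P] (hψ : IsRandomPotential P ψ) :
    IsFiniteKernel (lensLaw P ψ hψ) :=
  isFiniteKernel_weightedLaw (C := 1) ENNReal.one_ne_top fun _ => by simp

lemma lintegral_expectedPositive_ne_top [IsProbabilityMeasure P] (hψ : IsRandomPotential P ψ)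
    {D : Set Plane} (hD : IsCompact D) {K : ℝ}
    (hκ : ∀ᵐ ω ∂P, ∀ x ∈ lensPlane (ψ ω), |convergence (ψ ω) x| ≤ K) :
    ∫⁻ y, expectedPositive P ψ D y ≠ ∞ := by
  have := isFiniteKernel_jacLaw hψ hκ
  rw [← setLIntegral_univ, setLIntegral_expectedPositive hψ hD MeasurableSet.univ]
  refine ne_top_of_le_ne_top ?_ (lintegral_mono fun x => Kernel.measure_le_bound _ x univ)
  rw [lintegral_const, Measure.restrict_apply_univ]
  exact ENNReal.mul_ne_top (Kernel.bound_ne_top _) hD.measure_lt_top.ne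

end ExpectedNumber


/-! ### Densities and conditional expectations as Radon-Nikodym derivatives of kernels -/

section Fields

open ProbabilityTheory

variable {Ω : Type*}

lemma jacTerm_eq_max (ψ : Ω → Plane → ℝ) (x : Plane) (ω : Ω) :
    jacTerm ψ x ω = max (jacDet (ψ ω) x) 0 := by
  by_cases h : 0 < jacDet (ψ ω) x
  · have hx : x ∈ positiveRegion (ψ ω) := h
    rw [jacTerm, indicator_of_mem hx, mul_one, max_eq_left h.le]
  · have hx : x ∉ positiveRegion (ψ ω) := h
    rw [jacTerm, indicator_of_notMem hx, mul_zero, max_eq_right (not_lt.1 h)]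

lemma jacTerm_eq_of_mem {ψ : Ω → Plane → ℝ} {x : Plane} {ω : Ω} (h : (ω, x) ∈ lensSet ψ) :
    jacTerm ψ x ω = max (jacField ψ (ω, x)) 0 := by
  rw [jacTerm_eq_max, jacField_of_mem h]

variable [MeasurableSpace Ω] {P : Measure Ω} {ψ : Ω → Plane → ℝ}

lemma IsCondExpGiven.congr {U U' : Ω → ℝ} {V : Ω → Plane} {c : Plane → ℝ}
    (h : IsCondExpGiven P U V c) (hU : U =ᵐ[P] U') : IsCondExpGiven P U' V c where
  aemeasurable := h.aemeasurable
  integrable := h.integrable.congr hU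
  measurable_version := h.measurable_version
  integrable_version := h.integrable_version
  setIntegral_eq B hB := (h.setIntegral_eq B hB).trans
    (integral_congr_ae (ae_restrict_of_ae hU))

/-- The Jacobian is `(1 - κ)² - Γ²` almost surely at almost every point, so both expressions have
the same conditional expectations. -/
lemma isCondExpField_shearTerm_iff [SFinite P] (hψ : IsRandomPotential P ψ) {D : Set Plane}
    {c : Plane → Plane → ℝ} :
    IsCondExpField P ψ D (shearTerm ψ) c ↔ IsCondExpField P ψ D (jacTerm ψ) c := by
  have heq : ∀ᵐ x ∂(volume.restrict D), shearTerm ψ x =ᵐ[P] jacTerm ψ x := by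
    filter_upwards [ae_restrict_of_ae (ae_ae_mem_lensSet hψ)] with x hx
    filter_upwards [hx] with ω hω
    rw [shearTerm, jacTerm, jacDet_eq_convergence_shear (contDiffAt_of_mem_lensPlane hω)]
  constructor <;> intro h <;> refine ⟨h.measurable_uncurry, ?_⟩
  · filter_upwards [h.ae_condExp, heq] with x hx he using hx.congr he
  · filter_upwards [h.ae_condExp, heq] with x hx he using hx.congr he.symm

lemma lensMap_ae_eq_lensField {x : Plane} (hx : ∀ᵐ ω ∂P, (ω, x) ∈ lensSet ψ) :
    (fun ω => lensMap (ψ ω) x) =ᵐ[P] fun ω => lensField ψ (ω, x) := by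
  filter_upwards [hx] with ω hω
  exact (lensField_of_mem hω).symm

lemma lensLaw_apply [SFinite P] (hψ : IsRandomPotential P ψ) {x : Plane}
    (hx : ∀ᵐ ω ∂P, (ω, x) ∈ lensSet ψ) :
    lensLaw P ψ hψ x = P.map fun ω => lensMap (ψ ω) x := by
  rw [lensLaw, weightedLaw_one, Measure.map_congr (lensMap_ae_eq_lensField hx)]

lemma jacLaw_apply [SFinite P] (hψ : IsRandomPotential P ψ) {x : Plane}
    (hx : ∀ᵐ ω ∂P, (ω, x) ∈ lensSet ψ) {B : Set Plane} (hB : MeasurableSet B) :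
    jacLaw P ψ hψ x B =
      ∫⁻ ω in (fun ω => lensMap (ψ ω) x) ⁻¹' B, ENNReal.ofReal (jacTerm ψ x ω) ∂P := by
  have hset : ((fun ω => lensField ψ (ω, x)) ⁻¹' B : Set Ω) =ᵐ[P]
      ((fun ω => lensMap (ψ ω) x) ⁻¹' B : Set Ω) := by
    filter_upwards [lensMap_ae_eq_lensField hx] with ω hω
    exact congrArg B hω.symm
  rw [jacLaw, weightedLaw_apply_eq_setLIntegral x hB, setLIntegral_congr hset]
  refine lintegral_congr_ae (ae_restrict_of_ae ?_)
  filter_upwards [hx] with ω hω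
  rw [jacTerm_eq_of_mem hω, ENNReal.ofReal_max]
  simp

lemma integrable_jacTerm [IsProbabilityMeasure P] (hψ : IsRandomPotential P ψ) {K : ℝ}
    (hκ : ∀ᵐ ω ∂P, ∀ x ∈ lensPlane (ψ ω), |convergence (ψ ω) x| ≤ K) {x : Plane}
    (hx : ∀ᵐ ω ∂P, (ω, x) ∈ lensSet ψ) : Integrable (jacTerm ψ x) P := by
  have hm : Measurable fun ω => max (jacField ψ (ω, x)) 0 :=
    ((measurable_jacField hψ).comp measurable_prodMk_right).max measurable_const
  have hint : Integrable (fun ω => max (jacField ψ (ω, x)) 0) P := by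
    refine Integrable.of_bound hm.aestronglyMeasurable ((1 + K) ^ 2) ?_
    filter_upwards [ae_jacField_le hκ] with ω hω
    rw [Real.norm_of_nonneg (le_max_right _ _)]
    exact max_le (hω x) (sq_nonneg _)
  refine hint.congr ?_
  filter_upwards [hx] with ω hω
  exact (jacTerm_eq_of_mem hω).symm

/-- The Radon-Nikodym derivative of the law of `η(x)`, as a kernel in `x`, is jointly measurable.
It is taken with respect to a finite measure equivalent to Lebesgue measure. -/
lemma exists_isDensityField [IsProbabilityMeasure P] (hψ : IsRandomPotential P ψ) {D : Set Plane}
    (hpdf : ∀ᵐ x ∂(volume.restrict D), HasPDF (fun ω => lensMap (ψ ω) x) P volume) :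
    ∃ f, IsDensityField P ψ D f := by
  have := isFiniteKernel_lensLaw (P := P) hψ
  let ν : Measure Plane := (volume : Measure Plane).toFinite
  have hν : (volume : Measure Plane) ≪ ν := absolutelyContinuous_toFinite _
  let κν : Kernel Plane Plane := Kernel.const Plane ν
  refine ⟨fun x y => ((lensLaw P ψ hψ).rnDeriv κν x y * ν.rnDeriv volume y).toReal,
    ((Kernel.measurable_rnDeriv _ _).mul
      ((Measure.measurable_rnDeriv _ _).comp measurable_snd)).ennreal_toReal, ?_⟩
  filter_upwards [hpdf, ae_restrict_of_ae (ae_ae_mem_lensSet hψ)] with x hx hxL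
  have hac : lensLaw P ψ hψ x ≪ ν := by
    rw [lensLaw_apply hψ hxL]
    exact HasPDF.absolutelyContinuous.trans hν
  have h1 : (lensLaw P ψ hψ).rnDeriv κν x =ᵐ[volume] (lensLaw P ψ hψ x).rnDeriv ν :=
    hν.ae_eq (Kernel.rnDeriv_eq_rnDeriv_measure (κ := lensLaw P ψ hψ) (η := κν) (a := x))
  filter_upwards [h1, Measure.rnDeriv_mul_rnDeriv (κ := volume) hac] with y hy1 hy2
  rw [hy1, pdf_def, ← lensLaw_apply hψ hxL, ← hy2, Pi.mul_apply]

/-- The conditional expectation of the Jacobian term is the Radon-Nikodym derivative of its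
weighted law with respect to the law of `η(x)`. -/
lemma exists_isCondExpField [IsProbabilityMeasure P] (hψ : IsRandomPotential P ψ) {D : Set Plane}
    {K : ℝ} (hκ : ∀ᵐ ω ∂P, ∀ x ∈ lensPlane (ψ ω), |convergence (ψ ω) x| ≤ K) :
    ∃ c, IsCondExpField P ψ D (jacTerm ψ) c := by
  have := isFiniteKernel_lensLaw (P := P) hψ
  have := isFiniteKernel_jacLaw hψ hκ
  have hmeas := Kernel.measurable_rnDeriv (jacLaw P ψ hψ) (lensLaw P ψ hψ)
  refine ⟨fun x y => ((jacLaw P ψ hψ).rnDeriv (lensLaw P ψ hψ) x y).toReal,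
    hmeas.ennreal_toReal, ?_⟩
  filter_upwards [ae_restrict_of_ae (ae_ae_mem_lensSet hψ)] with x hxL
  have hac : jacLaw P ψ hψ x ≪ lensLaw P ψ hψ x := weightedLaw_absolutelyContinuous x
  have hmx : Measurable ((jacLaw P ψ hψ).rnDeriv (lensLaw P ψ hψ) x) :=
    Kernel.measurable_rnDeriv_right _ _ x
  have hV : AEMeasurable (fun ω => lensMap (ψ ω) x) P :=
    ⟨_, (measurable_lensField hψ).comp measurable_prodMk_right, lensMap_ae_eq_lensField hxL⟩
  refine ⟨hV, integrable_jacTerm hψ hκ hxL, hmx.ennreal_toReal, ?_, fun B hB => ?_⟩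
  · rw [← lensLaw_apply hψ hxL]
    refine integrable_toReal_of_lintegral_ne_top hmx.aemeasurable ?_
    rw [Kernel.lintegral_rnDeriv hac]
    exact measure_ne_top _ _
  · rw [← lensLaw_apply hψ hxL, integral_toReal hmx.aemeasurable
      (ae_restrict_of_ae (Kernel.rnDeriv_lt_top _ _)), Kernel.setLIntegral_rnDeriv hac hB,
      jacLaw_apply hψ hxL hB, integral_eq_lintegral_of_nonneg_ae
        (Eventually.of_forall fun ω => by
          rw [jacTerm_eq_max]; exact le_max_right _ _)
        (integrable_jacTerm hψ hκ hxL).aestronglyMeasurable.restrict]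

/-! ### The formula for almost every source -/

/-- A version of the conditional expectation times a density of `η(x)` is a nonnegative density of
the weighted law. -/
lemma density_mul_condExp [IsProbabilityMeasure P] (hψ : IsRandomPotential P ψ)
    {x : Plane} (hxL : ∀ᵐ ω ∂P, (ω, x) ∈ lensSet ψ)
    (hpdf : HasPDF (fun ω => lensMap (ψ ω) x) P volume)
    {f c : Plane → ℝ}
    (hf : ∀ᵐ y, f y = (pdf (fun ω => lensMap (ψ ω) x) P volume y).toReal)
    (hc : IsCondExpGiven P (jacTerm ψ x) (fun ω => lensMap (ψ ω) x) c) :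
    (∀ᵐ y, 0 ≤ c y * f y) ∧ ∀ B, MeasurableSet B →
      ∫⁻ y in B, ENNReal.ofReal (c y * f y) = jacLaw P ψ hψ x B := by
  set V : Ω → Plane := fun ω => lensMap (ψ ω) x with hVdef
  have hU0 : ∀ ω, 0 ≤ jacTerm ψ x ω := fun ω => by rw [jacTerm_eq_max]; exact le_max_right _ _
  have hc0 : 0 ≤ᵐ[P.map V] c := ae_nonneg_of_forall_setIntegral_nonneg hc.integrable_version
    fun B hB _ => by
      rw [hc.setIntegral_eq B hB]
      exact integral_nonneg hU0
  have hmap : P.map V = volume.withDensity (pdf V P volume) := map_eq_withDensity_pdf V P volume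
  have hpm : Measurable (pdf V P volume) := measurable_pdf V P volume
  have hpt : ∀ᵐ y, pdf V P volume y < ∞ := pdf.ae_lt_top
  have hc0' : ∀ᵐ y, pdf V P volume y ≠ 0 → 0 ≤ c y := by
    rw [hmap] at hc0
    exact (ae_withDensity_iff hpm).1 hc0
  refine ⟨?_, fun B hB => ?_⟩
  · filter_upwards [hf, hc0'] with y hy h0
    rw [hy]
    by_cases hp : pdf V P volume y = 0
    · simp [hp]
    · exact mul_nonneg (h0 hp) ENNReal.toReal_nonneg
  · have h1 : ∫⁻ y in B, ENNReal.ofReal (c y * f y) =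
        ∫⁻ y in B, (pdf V P volume * fun y => ENNReal.ofReal (c y)) y := by
      refine lintegral_congr_ae (ae_restrict_of_ae ?_)
      filter_upwards [hf, hpt] with y hy ht
      rw [hy, ENNReal.ofReal_mul' ENNReal.toReal_nonneg, ENNReal.ofReal_toReal ht.ne, mul_comm]
      rfl
    rw [h1, ← setLIntegral_withDensity_eq_setLIntegral_mul _ hpm
      hc.measurable_version.ennreal_ofReal hB, ← hmap,
      ← ofReal_integral_eq_lintegral_ofReal hc.integrable_version.integrableOn
        (ae_restrict_of_ae hc0), hc.setIntegral_eq B hB,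
      ofReal_integral_eq_lintegral_ofReal hc.integrable.integrableOn
        (Eventually.of_forall hU0), jacLaw_apply hψ hxL hB]

/-- The Kac-Rice formula: both sides have the same integral over every Borel set of sources. -/
lemma kacRice [IsProbabilityMeasure P] (hψ : IsRandomPotential P ψ) {D : Set Plane}
    (hD : IsCompact D)
    (hpdf : ∀ᵐ x ∂(volume.restrict D), HasPDF (fun ω => lensMap (ψ ω) x) P volume)
    {K : ℝ} (hκ : ∀ᵐ ω ∂P, ∀ x ∈ lensPlane (ψ ω), |convergence (ψ ω) x| ≤ K)
    {f c : Plane → Plane → ℝ} (hf : IsDensityField P ψ D f)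
    (hc : IsCondExpField P ψ D (jacTerm ψ) c) :
    ∀ᵐ y : Plane, IntegrableOn (fun x => c x y * f x y) D ∧
      (expectedPositive P ψ D y).toReal = ∫ x in D, c x y * f x y := by
  have hcf : Measurable fun p : Plane × Plane => c p.1 p.2 * f p.1 p.2 :=
    hc.measurable_uncurry.mul hf.measurable_uncurry
  have hx : ∀ᵐ x ∂(volume.restrict D), (∀ᵐ y, 0 ≤ c x y * f x y) ∧ ∀ B, MeasurableSet B →
      ∫⁻ y in B, ENNReal.ofReal (c x y * f x y) = jacLaw P ψ hψ x B := by
    filter_upwards [hpdf, ae_restrict_of_ae (ae_ae_mem_lensSet hψ), hf.ae_eq_pdf, hc.ae_condExp]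
      with x h1 h2 h3 h4 using density_mul_condExp hψ h2 h1 h3 h4
  have hnn : ∀ᵐ y : Plane, ∀ᵐ x ∂(volume.restrict D), 0 ≤ c x y * f x y :=
    (Measure.ae_ae_comm (p := fun x y => 0 ≤ c x y * f x y)
      (measurableSet_le measurable_const hcf)).1 (hx.mono fun x h => h.1)
  have hE : expectedPositive P ψ D =ᵐ[volume]
      fun y => ∫⁻ x in D, ENNReal.ofReal (c x y * f x y) := by
    refine ae_eq_of_forall_setLIntegral_eq_of_sigmaFinite (measurable_expectedPositive hψ hD)
      hcf.ennreal_ofReal.lintegral_prod_left' fun B hB _ => ?_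
    have hswap : ∫⁻ y in B, (∫⁻ x in D, ENNReal.ofReal (c x y * f x y)) =
        ∫⁻ x in D, (∫⁻ y in B, ENNReal.ofReal (c x y * f x y)) :=
      lintegral_lintegral_swap (f := fun y x => ENNReal.ofReal (c x y * f x y))
        (hcf.ennreal_ofReal.comp measurable_swap).aemeasurable
    rw [setLIntegral_expectedPositive hψ hD hB, hswap]
    refine lintegral_congr_ae ?_
    filter_upwards [hx] with x h
    exact (h.2 B hB).symm
  have hfin : ∀ᵐ y, expectedPositive P ψ D y < ∞ :=
    ae_lt_top (measurable_expectedPositive hψ hD) (lintegral_expectedPositive_ne_top hψ hD hκ)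
  filter_upwards [hnn, hE, hfin] with y h0 he ht
  have hm : AEStronglyMeasurable (fun x => c x y * f x y) (volume.restrict D) :=
    (hcf.comp measurable_prodMk_right).aestronglyMeasurable
  refine ⟨(lintegral_ofReal_ne_top_iff_integrable hm h0).1 (he ▸ ht.ne), ?_⟩
  rw [he, integral_eq_lintegral_of_nonneg_ae h0 hm]

end Fields

end Lensing

end

open Lensing in
theorem theorem2 {Ω : Type*} [MeasurableSpace Ω] (P : Measure Ω) [IsProbabilityMeasure P]
    (ψ : Ω → Plane → ℝ) (hψ : IsRandomPotential P ψ)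
    (x₀ : Plane) (r : ℝ) (hr : 0 < r) (D : Set Plane) (hD : D = Metric.closedBall x₀ r)
    -- the random vectors `η(x)` have probability density functions
    (hpdf : ∀ᵐ x ∂(volume.restrict D), HasPDF (fun ω => lensMap (ψ ω) x) P volume)
    -- images in `D` are almost surely not critical points of `η`
    (hcrit : ∀ᵐ y : Plane,
      P {ω | ∃ x ∈ D ∩ lensPlane (ψ ω), lensMap (ψ ω) x = y ∧ jacDet (ψ ω) x = 0} = 0)
    -- the convergence is bounded on the lens plane
    (hκ : ∃ K : ℝ, ∀ᵐ ω ∂P, ∀ x ∈ lensPlane (ψ ω), |convergence (ψ ω) x| ≤ K) :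
    -- the number of positive parity images is a random variable with finite expectation
    (∀ᵐ y : Plane, AEMeasurable (fun ω => (numPositive (ψ ω) D y : ℝ≥0∞)) P ∧
      expectedPositive P ψ D y ≠ ∞) ∧
    -- jointly measurable densities and conditional expectations exist
    (∃ f, IsDensityField P ψ D f) ∧
    (∃ c, IsCondExpField P ψ D (jacTerm ψ) c) ∧
    (∃ c, IsCondExpField P ψ D (shearTerm ψ) c) ∧
    -- and, for every choice of them:
    ∀ f, IsDensityField P ψ D f →
      -- the formula integrated against test functions
      (∀ c, IsCondExpField P ψ D (jacTerm ψ) c →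
        (∀ᵐ y : Plane, IntegrableOn (fun x => c x y * f x y) D) ∧
        ∀ ρ : Plane → ℝ, Continuous ρ → HasCompactSupport ρ →
          Integrable (fun y => ρ y * (expectedPositive P ψ D y).toReal) ∧
          Integrable (fun y => ρ y * ∫ x in D, c x y * f x y) ∧
          ∫ y, ρ y * (expectedPositive P ψ D y).toReal =
            ∫ y, ρ y * ∫ x in D, c x y * f x y) ∧
      -- the pointwise Kac-Rice formula
      (∀ c, IsCondExpField P ψ D (shearTerm ψ) c →
        ∀ᵐ y : Plane,
          IntegrableOn (fun x => c x y * f x y) D ∧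
          (expectedPositive P ψ D y).toReal = ∫ x in D, c x y * f x y) := by
  
  obtain ⟨K, hκ⟩ := hκ
  have hDc : IsCompact D := hD ▸ isCompact_closedBall x₀ r
  have hmE := measurable_expectedPositive (P := P) hψ hDc
  have hfin := lintegral_expectedPositive_ne_top hψ hDc hκ
  obtain ⟨c₀, hc₀⟩ := exists_isCondExpField (D := D) hψ hκ
  refine ⟨?_, exists_isDensityField hψ hpdf, ⟨c₀, hc₀⟩,
    ⟨c₀, (isCondExpField_shearTerm_iff hψ).2 hc₀⟩, fun f hf => ⟨fun c hc => ?_, fun c hc => ?_⟩⟩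
  · filter_upwards [ae_lt_top hmE hfin] with y hy
    exact ⟨((measurable_numPositive hψ hDc).comp measurable_prodMk_right).aemeasurable, hy.ne⟩
  · have hkr := kacRice hψ hDc hpdf hκ hf hc
    refine ⟨hkr.mono fun y h => h.1, fun ρ hρ hρc => ?_⟩
    have hEint : Integrable fun y => (expectedPositive P ψ D y).toReal :=
      integrable_toReal_of_lintegral_ne_top hmE.aemeasurable hfin
    obtain ⟨C, hC⟩ := hρc.exists_bound_of_continuous hρ
    have hint : Integrable fun y => ρ y * (expectedPositive P ψ D y).toReal :=
      hEint.bdd_mul hρ.aestronglyMeasurable (Eventually.of_forall hC)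
    have heq : (fun y => ρ y * (expectedPositive P ψ D y).toReal) =ᵐ[volume]
        fun y => ρ y * ∫ x in D, c x y * f x y := by
      filter_upwards [hkr] with y hy
      rw [hy.2]
    exact ⟨hint, hint.congr heq, integral_congr_ae heq⟩
  · exact kacRice hψ hDc hpdf hκ hf ((isCondExpField_shearTerm_iff hψ).1 hc)
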